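/- Let $k\ge 2$ be an integer. An abelian square of length $2n$ over an alphabet $\Sigma$ is a string of the form $xx'$, where $x,x'\in\Sigma^n$ and $x'$ is a permutation of $x$ (for $n=0$ the empty string is counted). Let $f_k(n)$ be the number of abelian squares of length $2n$ over an alphabet with $k$ letters. Then, as $n\to\infty$ with $k$ fixed, $$f_k(n)\sim k^{2n+k/2}(4\pi n)^{(1-k)/2}.$$ Moreover, for every $n\ge 0$, $$f_k(n)=\sum_{\substack{n_1,\dots,n_k\ge 0\\ n_1+\cdots+n_k=n}}\left(\frac{n!}{n_1!\,n_2!\cdots n_k!}\right)^2,$$ so, equivalently, this sum is $\sim k^{2n+k/2}(4\pi n)^{(1-k)/2}$ as $n\to\infty$. -/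

import Mathlib

/-- A string `w` is an abelian square if `w = x x'` where `x'` is a permutation of `x`
(so that in particular `x` and `x'` have the same length). The empty string is allowed, so that
there is exactly one abelian square of length `0`. -/
def IsAbelianSquare {α : Type*} (w : List α) : Prop :=
  ∃ x x' : List α, w = x ++ x' ∧ x.Perm x'

/-- The set of abelian squares of length `2 n` over the alphabet `Fin k` with `k` letters. -/
def abelianSquares (k n : ℕ) : Set (List (Fin k)) :=
  {w | w.length = 2 * n ∧ IsAbelianSquare w}

/-- There are only finitely many abelian squares of a given length, so `Set.ncard` below is a
genuine count. -/
theorem abelianSquares_finite (k n : ℕ) : (abelianSquares k n).Finite :=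
  (List.finite_length_eq (Fin k) (2 * n)).subset fun _ hw => hw.1

/-- `f_k(n)`: the number of abelian squares of length `2 n` over an alphabet with `k` letters. -/
noncomputable def numAbelianSquares (k n : ℕ) : ℕ :=
  (abelianSquares k n).ncard

/-- The sum of the squares of the multinomial coefficients `n! / (n_1! ⋯ n_k!)` over all `k`-tuples
of nonnegative integers with `n_1 + ⋯ + n_k = n`. -/
def sumSqMultinomial (k n : ℕ) : ℕ :=
  ∑ c ∈ (Finset.univ : Finset (Fin k)).piAntidiag n, (Nat.multinomial Finset.univ c) ^ 2

/-!
Counting words by their letter multiplicities shows that the abelian squares of length `2 n` are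
counted by the sum of the squares of the multinomial coefficients (`numAbelianSquares_eq`).

For the asymptotics write `k = m + 1` and let `S θ = 1 + ∑ j, exp (i θ j)` for `θ` in the cube
`[-π, π] ^ m`. The multinomial coefficients are the Fourier coefficients of `S ^ n`, so by Parseval
their squares add up to `(2 π) ^ (-m) * ∫ ‖S θ‖ ^ (2 n)` (`integral_unitSum_pow`). The modulus of
`S` has its only maximum in the cube at the origin, and `k ^ 2 - ‖S θ‖ ^ 2` is the sum of
`1 - cos` over all differences of arguments, which is at least a positive
multiple of `∑ j, θ j ^ 2`. After the substitution `θ = t / √n`, Laplace's method is therefore a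
single application of dominated convergence (`tendsto_scaled_integral`): the normalised integrand tends to `exp (-q t)` with
`q t = (k * ∑ j, t j ^ 2 - (∑ j, t j) ^ 2) / k ^ 2`. The integral of this Gaussian is
`√k * √(π * k) ^ m` (`integral_exp_neg_limitForm`), which gives the constant.
-/

open MeasureTheory Filter Topology

/-! ### Abelian squares and multinomial coefficients -/

/-- The words of length `n` in which each letter `a` occurs exactly `c a` times are counted by the
multinomial coefficient: both numbers are the coefficient of `∏ a, X a ^ c a` in
`(∑ a, X a) ^ n`. -/
theorem card_words_eq_multinomial {k n : ℕ} (c : Fin k → ℕ) (hc : ∑ a, c a = n) :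
    ({x : Fin n → Fin k | (fun a => ({i | x i = a} : Finset (Fin n)).card) = c} :
      Finset (Fin n → Fin k)).card = Nat.multinomial Finset.univ c := by
  classical
  have key : ∀ d : Fin k → ℕ, ∏ a, (MvPolynomial.X a : MvPolynomial (Fin k) ℕ) ^ d a =
      MvPolynomial.monomial (Finsupp.equivFunOnFinite.symm d) 1 := fun d => by
    rw [MvPolynomial.monomial_eq, Finsupp.prod_fintype _ _ (fun _ => pow_zero _)]
    simp
  have h1 : (∑ a, (MvPolynomial.X a : MvPolynomial (Fin k) ℕ)) ^ n =
      ∑ x : Fin n → Fin k, MvPolynomial.monomial (Finsupp.equivFunOnFinite.symm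
        fun a => ({i | x i = a} : Finset (Fin n)).card) 1 := by
    rw [Fintype.sum_pow]
    refine Finset.sum_congr rfl fun x _ => ?_
    rw [← key, ← Finset.prod_fiberwise Finset.univ x]
    refine Finset.prod_congr rfl fun a _ => ?_
    rw [Finset.prod_congr rfl (g := fun _ => MvPolynomial.X a)
      (fun i hi => by rw [(Finset.mem_filter.1 hi).2]), Finset.prod_const]
  rw [Finset.sum_pow_eq_sum_piAntidiag] at h1
  have h2 := congrArg (MvPolynomial.coeff (Finsupp.equivFunOnFinite.symm c)) h1
  simp only [key, MvPolynomial.coeff_sum, MvPolynomial.coeff_monomial,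
    EmbeddingLike.apply_eq_iff_eq, ← nsmul_eq_mul, MvPolynomial.coeff_smul] at h2
  rw [Finset.card_filter, ← h2]
  simp [Finset.mem_piAntidiag, hc]

theorem ofFn_perm_iff {k n : ℕ} (x y : Fin n → Fin k) :
    (List.ofFn x).Perm (List.ofFn y) ↔
      (fun a => ({i | x i = a} : Finset (Fin n)).card) =
        fun a => ({i | y i = a} : Finset (Fin n)).card := by
  have h : ∀ (x : Fin n → Fin k) (a : Fin k),
      (List.ofFn x).count a = ({i | x i = a} : Finset (Fin n)).card := fun x a => by
    rw [List.ofFn_eq_map, ← Multiset.coe_count, ← Multiset.map_coe, Multiset.count_map]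
    simp [Finset.card, Finset.filter, eq_comm, Finset.univ, Fintype.elems]
  rw [List.perm_iff_count, funext_iff]
  simp only [h]

theorem numAbelianSquares_eq (k n : ℕ) : numAbelianSquares k n = sumSqMultinomial k n := by
  classical
  let cnt : (Fin n → Fin k) → Fin k → ℕ := fun x a => ({i | x i = a} : Finset (Fin n)).card
  let F : (Fin n → Fin k) × (Fin n → Fin k) → List (Fin k) :=
    fun p => List.ofFn p.1 ++ List.ofFn p.2
  let s : Finset ((Fin n → Fin k) × (Fin n → Fin k)) := {p | cnt p.1 = cnt p.2}
  have hF : Function.Injective F := fun p q h => by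
    obtain ⟨h1, h2⟩ := List.append_inj h (by simp)
    exact Prod.ext (List.ofFn_injective h1) (List.ofFn_injective h2)
  have hs : abelianSquares k n = F '' s := by
    ext w
    constructor
    · rintro ⟨hw, x, y, rfl, hxy⟩
      have hl := hxy.length_eq
      rw [List.length_append] at hw
      obtain rfl : x.length = n := by omega
      have hy : List.ofFn (fun i => y.get (i.cast hl)) = y := by
        rw [← List.ofFn_congr hl.symm, List.ofFn_get]
      refine ⟨(x.get, fun i => y.get (i.cast hl)), ?_, ?_⟩
      · simp only [s, cnt, Finset.coe_filter, Finset.mem_univ, true_and, Set.mem_ofPred_eq]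
        rw [← ofFn_perm_iff, hy, List.ofFn_get]
        exact hxy
      · simp only [F, hy, List.ofFn_get]
    · rintro ⟨p, hp, rfl⟩
      refine ⟨by simp [F]; omega, _, _, rfl, ?_⟩
      rw [ofFn_perm_iff]
      simpa [s] using hp
  rw [numAbelianSquares, hs, Set.ncard_image_of_injective _ hF, Set.ncard_coe_finset,
    sumSqMultinomial, Finset.card_eq_sum_card_fiberwise (f := fun p => cnt p.1)
      (t := (Finset.univ : Finset (Fin k)).piAntidiag n)]
  · refine Finset.sum_congr rfl fun c hc => ?_
    rw [← card_words_eq_multinomial c (Finset.mem_piAntidiag.1 hc).1, sq, ← Finset.card_product]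
    congr 1
    ext p
    simp only [s, cnt, Finset.mem_filter, Finset.mem_univ, true_and, Finset.mem_product]
    constructor
    · rintro ⟨h, h'⟩; exact ⟨h', h ▸ h'⟩
    · rintro ⟨h, h'⟩; exact ⟨h.trans h'.symm, h⟩
  · intro p _
    refine Finset.mem_coe.2 (Finset.mem_piAntidiag.2 ⟨?_, fun a _ => Finset.mem_univ a⟩)
    simp only [cnt]
    rw [Finset.sum_card_fiberwise_eq_card_filter]
    simp

/-! ### Parseval's identity on the torus -/

theorem integral_exp_int_mul (d : ℤ) :
    ∫ x in Set.Icc (-Real.pi) Real.pi, Complex.exp (d * x * Complex.I) =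
      if d = 0 then 2 * (Real.pi : ℂ) else 0 := by
  rw [integral_Icc_eq_integral_Ioc, ← intervalIntegral.integral_of_le (by linarith [Real.pi_pos])]
  split_ifs with h
  · subst h
    simp
    ring
  · have h' : (d : ℂ) * Complex.I ≠ 0 := mul_ne_zero (by exact_mod_cast h) Complex.I_ne_zero
    have : ∀ x : ℝ, (d : ℂ) * x * Complex.I = d * Complex.I * x := fun x => by ring
    simp only [this]
    rw [integral_exp_mul_complex h', div_eq_zero_iff, sub_eq_zero]
    refine Or.inl (Complex.exp_eq_exp_iff_exists_int.2 ⟨d, ?_⟩)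
    push_cast
    ring

/-- The cube `[-π, π] ^ m`, a fundamental domain of the torus of dimension `m`. -/
def torusBox (m : ℕ) : Set (Fin m → ℝ) := Set.univ.pi fun _ => Set.Icc (-Real.pi) Real.pi

theorem integral_box_exp (m : ℕ) (d : Fin m → ℤ) :
    ∫ θ in torusBox m, ∏ j, Complex.exp (d j * θ j * Complex.I) =
      if d = 0 then (2 * (Real.pi : ℂ)) ^ m else 0 := by
  rw [torusBox, volume_pi, Measure.restrict_pi_pi,
    integral_fintype_prod_eq_prod (𝕜 := ℂ) (fun j (x : ℝ) => Complex.exp (d j * x * Complex.I))]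
  simp only [integral_exp_int_mul]
  split_ifs with h
  · simp [h]
  · obtain ⟨j, hj⟩ := Function.ne_iff.1 h
    exact Finset.prod_eq_zero (Finset.mem_univ j) (if_neg hj)

theorem isCompact_torusBox (m : ℕ) : IsCompact (torusBox m) :=
  isCompact_univ_pi fun _ => isCompact_Icc

/-- Parseval's identity for a trigonometric polynomial on the torus with distinct
frequencies `v c`. -/
theorem integral_normSq_trigPoly {ι : Type*} (m : ℕ) (s : Finset ι) (a : ι → ℝ) (v : ι → Fin m → ℕ)
    (hv : Set.InjOn v s) :
    ∫ θ in torusBox m, ‖∑ c ∈ s, (a c : ℂ) * ∏ j, Complex.exp (θ j * Complex.I) ^ v c j‖ ^ 2 =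
      (2 * Real.pi) ^ m * ∑ c ∈ s, a c ^ 2 := by
  classical
  have h : ∀ θ : Fin m → ℝ,
      ((‖∑ c ∈ s, (a c : ℂ) * ∏ j, Complex.exp (θ j * Complex.I) ^ v c j‖ ^ 2 : ℝ) : ℂ) =
      ∑ c ∈ s, ∑ c' ∈ s, (a c : ℂ) * a c' *
        ∏ j, Complex.exp ((((v c j : ℤ) - (v c' j : ℤ) : ℤ) : ℂ) * θ j * Complex.I) := fun θ => by
    push_cast
    rw [← Complex.mul_conj', map_sum, Finset.sum_mul_sum]
    refine Finset.sum_congr rfl fun c _ => Finset.sum_congr rfl fun c' _ => ?_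
    rw [map_mul, map_prod, Complex.conj_ofReal, mul_mul_mul_comm, ← Finset.prod_mul_distrib]
    congr 1
    refine Finset.prod_congr rfl fun j _ => ?_
    rw [map_pow, ← Complex.exp_conj, ← Complex.exp_nat_mul, ← Complex.exp_nat_mul,
      ← Complex.exp_add, map_mul, Complex.conj_I, Complex.conj_ofReal]
    congr 1
    ring
  have h_int : ∀ c c' : ι, Integrable (fun θ : Fin m → ℝ => (a c : ℂ) * a c' *
        ∏ j, Complex.exp ((((v c j : ℤ) - (v c' j : ℤ) : ℤ) : ℂ) * θ j * Complex.I))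
        (volume.restrict (torusBox m)) := fun c c' =>
    ContinuousOn.integrableOn_compact (isCompact_torusBox m) (by fun_prop)
  apply Complex.ofReal_injective
  rw [← integral_complex_ofReal]
  simp only [h]
  rw [integral_finsetSum _ fun c _ => integrable_finsetSum _ fun c' _ => h_int c c']
  rw [Complex.ofReal_mul, Complex.ofReal_sum, Finset.mul_sum]
  refine Finset.sum_congr rfl fun c hc => ?_
  rw [integral_finsetSum _ fun c' _ => h_int c c', Finset.sum_eq_single_of_mem c hc]
  · rw [integral_const_mul, integral_box_exp m (fun j => (v c j : ℤ) - v c j)]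
    simp [funext_iff]
    ring
  · intro c' hc' hne
    rw [integral_const_mul, integral_box_exp m (fun j => (v c j : ℤ) - v c' j), if_neg, mul_zero]
    intro h0
    refine hne (hv hc' hc (funext fun j => ?_))
    have := congrFun h0 j
    simp at this
    omega

/-- The sum of `m + 1` complex numbers of absolute value `1`, the first of which is rotated to `1`
and the others of which have arguments `θ j`. -/
noncomputable def unitSum {m : ℕ} (θ : Fin m → ℝ) : ℂ := 1 + ∑ j, Complex.exp (θ j * Complex.I)

/-- The coefficients of `unitSum θ ^ n` as a trigonometric polynomial are the multinomial
coefficients, so Parseval's identity turns the sum of their squares into an integral. -/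
theorem integral_unitSum_pow (m n : ℕ) :
    ∫ θ in torusBox m, (‖unitSum θ‖ ^ 2) ^ n =
      (2 * Real.pi) ^ m * sumSqMultinomial (m + 1) n := by
  have h : ∀ θ : Fin m → ℝ, (‖unitSum θ‖ ^ 2) ^ n =
      ‖∑ c ∈ (Finset.univ : Finset (Fin (m + 1))).piAntidiag n,
        ((Nat.multinomial Finset.univ c : ℝ) : ℂ) *
          ∏ j, Complex.exp (θ j * Complex.I) ^ c j.succ‖ ^ 2 := fun θ => by
    have := Finset.sum_pow_eq_sum_piAntidiag Finset.univ
      (Fin.cons 1 fun j => Complex.exp (θ j * Complex.I) : Fin (m + 1) → ℂ) n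
    simp only [Fin.sum_univ_succ, Fin.prod_univ_succ, Fin.cons_zero, Fin.cons_succ, one_pow,
      one_mul] at this
    rw [← pow_mul, mul_comm, pow_mul, ← norm_pow, unitSum, this]
    simp
  simp only [h]
  rw [integral_normSq_trigPoly m _ (fun c => (Nat.multinomial Finset.univ c : ℝ))
    (fun c j => c j.succ), sumSqMultinomial]
  · push_cast
    rfl
  · -- The frequency omits the exponent of the constant summand `1`, which is recovered from the
    -- total degree `n`.
    intro c hc c' hc' hcc
    rw [Finset.mem_coe, Finset.mem_piAntidiag, Fin.sum_univ_succ] at hc hc'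
    have hs : ∀ j : Fin m, c j.succ = c' j.succ := congrFun hcc
    have h0 : c 0 = c' 0 := by
      have h1 := hc.1
      have h2 := hc'.1
      rw [Finset.sum_congr rfl fun j _ => hs j] at h1
      omega
    exact funext fun a => Fin.cases h0 hs a

/-! ### Laplace's method -/

/-- The amount by which `‖unitSum θ‖ ^ 2` falls short of its maximum `(m + 1) ^ 2`; the arguments of
the summands are `Fin.cons 0 θ`. -/
noncomputable def phaseDefect {m : ℕ} (θ : Fin m → ℝ) : ℝ :=
  ∑ a : Fin (m + 1), ∑ b : Fin (m + 1),
    (1 - Real.cos ((Fin.cons 0 θ : Fin (m + 1) → ℝ) a - (Fin.cons 0 θ : Fin (m + 1) → ℝ) b))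

theorem normSq_unitSum {m : ℕ} (θ : Fin m → ℝ) :
    ‖unitSum θ‖ ^ 2 = ((m + 1 : ℕ) : ℝ) ^ 2 - phaseDefect θ := by
  have h : unitSum θ =
      ∑ a, Complex.exp ((Fin.cons 0 θ : Fin (m + 1) → ℝ) a * Complex.I) := by
    simp [Fin.sum_univ_succ, unitSum]
  have h1 : ((‖unitSum θ‖ ^ 2 : ℝ) : ℂ).re = ∑ a : Fin (m + 1), ∑ b : Fin (m + 1),
      Real.cos ((Fin.cons 0 θ : Fin (m + 1) → ℝ) a - (Fin.cons 0 θ : Fin (m + 1) → ℝ) b) := by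
    rw [Complex.ofReal_pow, ← Complex.mul_conj', h, map_sum, Finset.sum_mul_sum, Complex.re_sum]
    refine Finset.sum_congr rfl fun a _ => ?_
    rw [Complex.re_sum]
    refine Finset.sum_congr rfl fun b _ => ?_
    rw [← Complex.exp_conj, ← Complex.exp_add, map_mul, Complex.conj_I, Complex.conj_ofReal,
      mul_neg, ← sub_eq_add_neg, ← sub_mul, ← Complex.ofReal_sub, Complex.exp_ofReal_mul_I_re]
  rw [Complex.ofReal_re] at h1
  rw [h1, phaseDefect]
  simp only [Finset.sum_sub_distrib, Finset.sum_const, Finset.card_univ, Fintype.card_fin]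
  simp
  ring

/-- Quadratic growth of the defect on the whole cube, from the pairs that contain the
summand `1`. -/
theorem phaseDefect_ge {m : ℕ} {θ : Fin m → ℝ} (hθ : θ ∈ torusBox m) :
    2 / Real.pi ^ 2 * ∑ j, θ j ^ 2 ≤ phaseDefect θ := by
  have hnn : ∀ x : ℝ, 0 ≤ 1 - Real.cos x := fun x => sub_nonneg.2 (Real.cos_le_one x)
  calc 2 / Real.pi ^ 2 * ∑ j, θ j ^ 2 ≤ ∑ j, (1 - Real.cos (θ j)) := by
        rw [Finset.mul_sum]
        refine Finset.sum_le_sum fun j _ => ?_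
        have := Real.cos_le_one_sub_mul_cos_sq (abs_le.2 (hθ j (Set.mem_univ j)))
        linarith
    _ ≤ ∑ b : Fin (m + 1), (1 - Real.cos ((Fin.cons 0 θ : Fin (m + 1) → ℝ) 0 -
          (Fin.cons 0 θ : Fin (m + 1) → ℝ) b)) := by
        simp only [Fin.sum_univ_succ, Fin.cons_zero, Fin.cons_succ, zero_sub, Real.cos_neg,
          sub_self, Real.cos_zero, zero_add, le_refl]
    _ ≤ phaseDefect θ :=
        Finset.single_le_sum (f := fun a : Fin (m + 1) => ∑ b : Fin (m + 1),
          (1 - Real.cos ((Fin.cons 0 θ : Fin (m + 1) → ℝ) a -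
            (Fin.cons 0 θ : Fin (m + 1) → ℝ) b)))
          (fun a _ => Finset.sum_nonneg fun b _ => hnn _) (Finset.mem_univ 0)

theorem tendsto_inv_sqrt_natCast : Tendsto (fun n : ℕ => (√(n : ℝ))⁻¹) atTop (𝓝 0) :=
  tendsto_inv_atTop_zero.comp (Real.tendsto_sqrt_atTop.comp tendsto_natCast_atTop_atTop)

theorem tendsto_nat_mul_one_sub_cos (d : ℝ) :
    Tendsto (fun n : ℕ => (n : ℝ) * (1 - Real.cos ((√(n : ℝ))⁻¹ * d))) atTop (𝓝 (d ^ 2 / 2)) := by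
  have h : Tendsto (fun n : ℕ => d ^ 2 / 2 * Real.sinc ((√(n : ℝ))⁻¹ * (d / 2)) ^ 2) atTop
      (𝓝 (d ^ 2 / 2 * Real.sinc (0 * (d / 2)) ^ 2)) :=
    (((Real.continuous_sinc.tendsto _).comp
      (tendsto_inv_sqrt_natCast.mul_const (d / 2))).pow 2).const_mul _
  rw [zero_mul, Real.sinc_zero, one_pow, mul_one] at h
  refine h.congr' ?_
  filter_upwards [eventually_gt_atTop 0] with n hn
  have hn' : (0 : ℝ) < n := by exact_mod_cast hn
  have hs : √(n : ℝ) ^ 2 = n := Real.sq_sqrt hn'.le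
  have hs0 : √(n : ℝ) ≠ 0 := (Real.sqrt_pos.2 hn').ne'
  have h2 : (√(n : ℝ))⁻¹ * d = 2 * ((√(n : ℝ))⁻¹ * (d / 2)) := by ring
  rw [h2, Real.cos_two_mul', Real.cos_sq']
  -- Here `1 - cos (2 * x) = 2 * sin x ^ 2`, and `sin x = x * sinc x`.
  rcases eq_or_ne d 0 with rfl | hd
  · simp
  · rw [Real.sinc_of_ne_zero (by positivity), div_pow, mul_pow, inv_pow, hs]
    field_simp
    ring

theorem sum_sq_sub_cons {m : ℕ} (t : Fin m → ℝ) :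
    ∑ a : Fin (m + 1), ∑ b : Fin (m + 1),
      ((Fin.cons 0 t : Fin (m + 1) → ℝ) a - (Fin.cons 0 t : Fin (m + 1) → ℝ) b) ^ 2 / 2 =
    (m + 1) * ∑ j, t j ^ 2 - (∑ j, t j) ^ 2 := by
  have h : ∀ φ : Fin (m + 1) → ℝ, ∑ a, ∑ b, (φ a - φ b) ^ 2 / 2 =
      (m + 1) * ∑ a, φ a ^ 2 - (∑ a, φ a) ^ 2 := fun φ => by
    have : ∀ a b, (φ a - φ b) ^ 2 / 2 = φ a ^ 2 / 2 + φ b ^ 2 / 2 - φ a * φ b := fun a b => by ring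
    simp only [this, Finset.sum_sub_distrib, Finset.sum_add_distrib, ← Finset.mul_sum,
      ← Finset.sum_mul, Finset.sum_const, Finset.card_univ, Fintype.card_fin, ← Finset.sum_div,
      nsmul_eq_mul]
    push_cast
    ring
  rw [h]
  simp [Fin.sum_univ_succ]

/-- The quadratic form `q` such that `(‖unitSum (t / √n)‖ / (m + 1)) ^ (2 * n)` tends to
`exp (-q t)`. -/
noncomputable def limitForm {m : ℕ} (t : Fin m → ℝ) : ℝ :=
  ((m + 1) * ∑ j, t j ^ 2 - (∑ j, t j) ^ 2) / (m + 1) ^ 2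

theorem tendsto_unitSum_pow {m : ℕ} (t : Fin m → ℝ) :
    Tendsto (fun n : ℕ => (‖unitSum ((√(n : ℝ))⁻¹ • t)‖ ^ 2 / ((m + 1 : ℕ) : ℝ) ^ 2) ^ n) atTop
      (𝓝 (Real.exp (-limitForm t))) := by
  have hk : (((m + 1 : ℕ) : ℝ)) ^ 2 ≠ 0 := by positivity
  have h0 : Tendsto (fun n : ℕ => (n : ℝ) * phaseDefect ((√(n : ℝ))⁻¹ • t)) atTop
      (𝓝 ((m + 1) * ∑ j, t j ^ 2 - (∑ j, t j) ^ 2)) := by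
    rw [← sum_sq_sub_cons]
    simp only [phaseDefect, Finset.mul_sum]
    refine tendsto_finsetSum _ fun a _ => tendsto_finsetSum _ fun b _ => ?_
    refine (tendsto_nat_mul_one_sub_cos _).congr fun n => ?_
    have hc : ∀ a, (Fin.cons 0 ((√(n : ℝ))⁻¹ • t) : Fin (m + 1) → ℝ) a =
        (√(n : ℝ))⁻¹ * (Fin.cons 0 t : Fin (m + 1) → ℝ) a :=
      Fin.cases (by simp) (by simp)
    rw [hc, hc, ← mul_sub]
  have h1 := Real.tendsto_one_add_pow_exp_of_tendsto
    (g := fun n : ℕ => -(phaseDefect ((√(n : ℝ))⁻¹ • t) / ((m + 1 : ℕ) : ℝ) ^ 2))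
    (t := -limitForm t) (by
      have := (h0.div_const (((m + 1 : ℕ) : ℝ) ^ 2)).neg
      rw [limitForm]
      push_cast at this ⊢
      exact this.congr fun n => by ring)
  refine h1.congr fun n => ?_
  rw [normSq_unitSum, sub_div, div_self hk, sub_eq_add_neg]

/-- The Gaussian majorant, uniform in `n`, used for dominated convergence. -/
theorem unitSum_pow_le {m n : ℕ} {t : Fin m → ℝ} (hn : 0 < n)
    (ht : (√(n : ℝ))⁻¹ • t ∈ torusBox m) :
    (‖unitSum ((√(n : ℝ))⁻¹ • t)‖ ^ 2 / ((m + 1 : ℕ) : ℝ) ^ 2) ^ n ≤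
      ∏ j, Real.exp (-(2 / (Real.pi ^ 2 * ((m + 1 : ℕ) : ℝ) ^ 2)) * t j ^ 2) := by
  have hk : (0 : ℝ) < (((m + 1 : ℕ) : ℝ)) ^ 2 := by positivity
  have hn' : (0 : ℝ) < n := by exact_mod_cast hn
  have hD := phaseDefect_ge ht
  have hx : ∀ j, ((√(n : ℝ))⁻¹ • t) j ^ 2 = (n : ℝ)⁻¹ * t j ^ 2 := fun j => by
    rw [Pi.smul_apply, smul_eq_mul, mul_pow, inv_pow, Real.sq_sqrt hn'.le]
  simp only [hx, ← Finset.mul_sum] at hD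
  rw [← Real.exp_sum, ← Finset.mul_sum]
  calc (‖unitSum ((√(n : ℝ))⁻¹ • t)‖ ^ 2 / ((m + 1 : ℕ) : ℝ) ^ 2) ^ n
      ≤ Real.exp (-(phaseDefect ((√(n : ℝ))⁻¹ • t) / ((m + 1 : ℕ) : ℝ) ^ 2)) ^ n := by
        refine pow_le_pow_left₀ (by positivity) ?_ n
        rw [normSq_unitSum, sub_div, div_self hk.ne']
        exact Real.one_sub_le_exp_neg _
    _ = Real.exp (n * -(phaseDefect ((√(n : ℝ))⁻¹ • t) / ((m + 1 : ℕ) : ℝ) ^ 2)) :=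
        (Real.exp_nat_mul _ n).symm
    _ ≤ _ := by
        refine Real.exp_le_exp.2 ?_
        have : (2 / (Real.pi ^ 2 * ((m + 1 : ℕ) : ℝ) ^ 2)) * ∑ j, t j ^ 2 =
            n * (2 / Real.pi ^ 2 * ((n : ℝ)⁻¹ * ∑ j, t j ^ 2) / ((m + 1 : ℕ) : ℝ) ^ 2) := by
          field_simp
        rw [mul_neg, neg_mul, this]
        gcongr

theorem measurableSet_torusBox (m : ℕ) : MeasurableSet (torusBox m) :=
  (isCompact_torusBox m).measurableSet

theorem continuous_unitSum (m : ℕ) : Continuous (unitSum : (Fin m → ℝ) → ℂ) := by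
  unfold unitSum
  fun_prop

theorem torusBox_mem_nhds (m : ℕ) : torusBox m ∈ 𝓝 (0 : Fin m → ℝ) :=
  set_pi_mem_nhds Set.finite_univ fun _ _ =>
    Icc_mem_nhds (by simpa using Real.pi_pos) (by simpa using Real.pi_pos)

theorem tendsto_scaled_integral (m : ℕ) :
    Tendsto (fun n : ℕ => ∫ t : Fin m → ℝ, (torusBox m).indicator
        (fun θ => (‖unitSum θ‖ ^ 2 / ((m + 1 : ℕ) : ℝ) ^ 2) ^ n) ((√(n : ℝ))⁻¹ • t)) atTop
      (𝓝 (∫ t : Fin m → ℝ, Real.exp (-limitForm t))) := by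
  refine tendsto_integral_filter_of_dominated_convergence
    (fun t => ∏ j, Real.exp (-(2 / (Real.pi ^ 2 * ((m + 1 : ℕ) : ℝ) ^ 2)) * t j ^ 2)) ?_ ?_ ?_ ?_
  · refine Eventually.of_forall fun n => Measurable.aestronglyMeasurable ?_
    refine Measurable.comp (Measurable.indicator ?_ (measurableSet_torusBox m))
      (measurable_const_smul _)
    have := (continuous_unitSum m).measurable
    fun_prop
  · filter_upwards [eventually_gt_atTop 0] with n hn
    refine Eventually.of_forall fun t => ?_
    by_cases ht : (√(n : ℝ))⁻¹ • t ∈ torusBox m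
    · rw [Set.indicator_of_mem ht, Real.norm_of_nonneg (by positivity)]
      exact unitSum_pow_le hn ht
    · rw [Set.indicator_of_notMem ht, norm_zero]
      positivity
  · exact Integrable.fintype_prod fun j => integrable_exp_neg_mul_sq (by positivity)
  · refine Eventually.of_forall fun t => (tendsto_unitSum_pow t).congr' ?_
    have h : Tendsto (fun n : ℕ => (√(n : ℝ))⁻¹ • t) atTop (𝓝 0) := by
      simpa using tendsto_inv_sqrt_natCast.smul_const t
    filter_upwards [h.eventually (torusBox_mem_nhds m)] with n hn
    rw [Set.indicator_of_mem hn]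

/-- The substitution `θ = t / √n` in `integral_unitSum_pow`. -/
theorem scaled_integral_eq (m n : ℕ) :
    ∫ t : Fin m → ℝ, (torusBox m).indicator
        (fun θ => (‖unitSum θ‖ ^ 2 / ((m + 1 : ℕ) : ℝ) ^ 2) ^ n) ((√(n : ℝ))⁻¹ • t) =
      √(n : ℝ) ^ m * ((2 * Real.pi) ^ m * sumSqMultinomial (m + 1) n /
        ((m + 1 : ℕ) : ℝ) ^ (2 * n)) := by
  rw [Measure.integral_comp_smul volume (E := Fin m → ℝ), integral_indicator
    (measurableSet_torusBox m), Module.finrank_fin_fun, inv_pow, inv_inv, smul_eq_mul,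
    abs_of_nonneg (by positivity)]
  simp only [div_pow]
  rw [integral_div, integral_unitSum_pow, pow_mul]

/-! ### The Gaussian integral -/

/-- The Gaussian integral of the limiting form, computed by diagonalising the form through a
rank one perturbation of the identity of determinant `√(m + 1)`. -/
theorem integral_exp_neg_limitForm (m : ℕ) :
    ∫ t : Fin m → ℝ, Real.exp (-limitForm t) =
      √((m + 1 : ℕ) : ℝ) * √(Real.pi * ((m + 1 : ℕ) : ℝ)) ^ m := by
  set r : ℝ := √((m + 1 : ℕ) : ℝ) with hr
  have hr2 : r ^ 2 = (m : ℝ) + 1 := by rw [hr, Real.sq_sqrt (by positivity)]; push_cast; ring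
  have hr0 : 0 < r := Real.sqrt_pos.2 (by positivity)
  have hcr : (r + 1)⁻¹ * (r + 1) = 1 := inv_mul_cancel₀ (by positivity)
  -- With this `c`, the map `u ↦ u + c * (∑ i, u i) • 1` multiplies the coordinate sum by `r` and
  -- pulls `limitForm` back to a multiple of the Euclidean form.
  set c : ℝ := (r + 1)⁻¹ with hc
  set M : Matrix (Fin m) (Fin m) ℝ :=
    1 + Matrix.replicateCol Unit (fun _ : Fin m => c) *
      Matrix.replicateRow Unit (fun _ : Fin m => (1 : ℝ)) with hM
  have hcm : c * m = r - 1 := by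
    have : (m : ℝ) = (r + 1) * (r - 1) := by linarith
    rw [this, ← mul_assoc, hcr, one_mul]
  have hdet : M.det = r := by
    rw [hM, Matrix.det_one_add_replicateCol_mul_replicateRow]
    simp [dotProduct]
    linarith
  have happ : ∀ u j, Matrix.toLin' M u j = u j + c * ∑ i, u i := fun u j => by
    rw [Matrix.toLin'_apply, hM, Matrix.add_mulVec, Matrix.one_mulVec, Pi.add_apply]
    simp [Matrix.mulVec, dotProduct, Matrix.mul_apply, Finset.mul_sum]
  have hQ : ∀ u : Fin m → ℝ, limitForm (Matrix.toLin' M u) =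
      ((m + 1 : ℕ) : ℝ)⁻¹ * ∑ j, u j ^ 2 := fun u => by
    have h1 : ∑ j, Matrix.toLin' M u j = r * ∑ j, u j := by
      simp only [happ, Finset.sum_add_distrib, Finset.sum_const, Finset.card_univ,
        Fintype.card_fin, nsmul_eq_mul]
      linear_combination (∑ j, u j) * hcm
    have h2 : ∑ j, Matrix.toLin' M u j ^ 2 =
        ∑ j, u j ^ 2 + (2 * c + c ^ 2 * m) * (∑ j, u j) ^ 2 := by
      simp only [happ, add_sq, Finset.sum_add_distrib, Finset.sum_const, Finset.card_univ,
        Fintype.card_fin, nsmul_eq_mul, ← Finset.sum_mul, ← Finset.mul_sum]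
      ring
    have h3 : 2 * c + c ^ 2 * m = 1 := by linear_combination c * hcm + hcr
    rw [limitForm, h1, h2, h3, mul_pow, hr2]
    push_cast
    field_simp
    ring
  have hmap := Real.map_matrix_volume_pi_eq_smul_volume_pi (M := M) (by rw [hdet]; exact hr0.ne')
  have hcont : Continuous fun t : Fin m → ℝ => Real.exp (-limitForm t) := by
    unfold limitForm
    fun_prop
  have h := integral_map (μ := volume) (φ := Matrix.toLin' M)
    (LinearMap.continuous_of_finiteDimensional _).aemeasurable
    (f := fun t : Fin m → ℝ => Real.exp (-limitForm t)) hcont.aestronglyMeasurable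
  rw [hmap, hdet, integral_smul_measure, ENNReal.toReal_ofReal (abs_nonneg _),
    abs_of_pos (inv_pos.2 hr0), smul_eq_mul, inv_mul_eq_iff_eq_mul₀ hr0.ne'] at h
  rw [h]
  congr 1
  have hprod : ∀ u : Fin m → ℝ, Real.exp (-limitForm (Matrix.toLin' M u)) =
      ∏ j, Real.exp (-((m + 1 : ℕ) : ℝ)⁻¹ * u j ^ 2) := fun u => by
    rw [hQ, ← Real.exp_sum, ← Finset.mul_sum, neg_mul]
  simp only [hprod]
  rw [integral_fintype_prod_volume_eq_pow (fun x : ℝ => Real.exp (-((m + 1 : ℕ) : ℝ)⁻¹ * x ^ 2)),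
    integral_gaussian, Fintype.card_fin, div_inv_eq_mul]

/-! ### The asymptotic formula -/

theorem sumSqMultinomial_isEquivalent (m : ℕ) :
    Asymptotics.IsEquivalent atTop (fun n : ℕ => (sumSqMultinomial (m + 1) n : ℝ))
      (fun n : ℕ => ((m + 1 : ℕ) : ℝ) ^ (2 * (n : ℝ) + ((m + 1 : ℕ) : ℝ) / 2) *
        (4 * Real.pi * (n : ℝ)) ^ ((1 - ((m + 1 : ℕ) : ℝ)) / 2)) := by
  set K : ℝ := ((m + 1 : ℕ) : ℝ) with hK
  have hK0 : 0 < K := by positivity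
  set G : ℝ := √K * √(Real.pi * K) ^ m with hG
  have hG0 : 0 < G := by have := Real.pi_pos; positivity
  have hlim := tendsto_scaled_integral m
  simp only [scaled_integral_eq, integral_exp_neg_limitForm] at hlim
  refine Asymptotics.isEquivalent_of_tendsto_one ?_
  have h1 := hlim.div_const G
  rw [div_self hG0.ne'] at h1
  refine h1.congr' ?_
  filter_upwards [eventually_gt_atTop 0] with n hn
  have hn' : (0 : ℝ) < n := by exact_mod_cast hn
  have hsq : ∀ x : ℝ, 0 ≤ x → √x ^ m = x ^ ((m : ℝ) / 2) := fun x hx => by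
    rw [Real.sqrt_eq_rpow, ← Real.rpow_natCast, ← Real.rpow_mul hx]
    ring_nf
  have hpow : K ^ (2 * (n : ℝ) + K / 2) = K ^ (2 * n) * (√K * √K ^ m) := by
    rw [hsq K hK0.le, Real.sqrt_eq_rpow, ← Real.rpow_natCast, ← Real.rpow_add hK0,
      ← Real.rpow_add hK0]
    congr 1
    rw [hK]
    push_cast
    ring
  have hneg : (4 * Real.pi * (n : ℝ)) ^ ((1 - K) / 2) = ((2 * √Real.pi * √(n : ℝ)) ^ m)⁻¹ := by
    have h4 : (2 * √Real.pi * √(n : ℝ)) = √(4 * Real.pi * n) := by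
      rw [Real.sqrt_mul (by positivity), Real.sqrt_mul (by norm_num),
        show (4 : ℝ) = 2 ^ 2 by norm_num, Real.sqrt_sq (by norm_num)]
    rw [h4, hsq _ (by positivity), ← Real.rpow_neg (by positivity)]
    congr 1
    rw [hK]
    push_cast
    ring
  have hpi : Real.pi ^ m = √Real.pi ^ m * √Real.pi ^ m := by
    rw [← mul_pow, Real.mul_self_sqrt Real.pi_pos.le]
  rw [Pi.div_apply, hpow, hneg, hG, Real.sqrt_mul Real.pi_pos.le, ← hK]
  simp only [mul_pow, hpi]
  field_simp

theorem theorem1 (k : ℕ) (hk : 2 ≤ k) :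
    Asymptotics.IsEquivalent Filter.atTop
      (fun n : ℕ => (numAbelianSquares k n : ℝ))
      (fun n : ℕ => (k : ℝ) ^ (2 * (n : ℝ) + (k : ℝ) / 2) *
        (4 * Real.pi * (n : ℝ)) ^ ((1 - (k : ℝ)) / 2)) ∧
    (∀ n : ℕ, numAbelianSquares k n = sumSqMultinomial k n) ∧
    Asymptotics.IsEquivalent Filter.atTop
      (fun n : ℕ => (sumSqMultinomial k n : ℝ))
      (fun n : ℕ => (k : ℝ) ^ (2 * (n : ℝ) + (k : ℝ) / 2) *
        (4 * Real.pi * (n : ℝ)) ^ ((1 - (k : ℝ)) / 2)) := by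
  obtain ⟨m, rfl⟩ : ∃ m, k = m + 1 := ⟨k - 1, by omega⟩
  have h := sumSqMultinomial_isEquivalent m
  refine ⟨?_, numAbelianSquares_eq (m + 1), h⟩
  simp only [numAbelianSquares_eq]
  exact h
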